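/- Consider a chain of $N\ge 1$ spin-$\tfrac12$ particles with uniform nearest-neighbour Heisenberg coupling, i.e. with Hamiltonian $$H_s=\frac{\gamma}{2}\sum_{n=1}^{N-1}\bigl(X_nX_{n+1}+Y_nY_{n+1}+Z_nZ_{n+1}\bigr),\qquad \gamma\in\mathbb{R},\ \gamma\neq 0,$$ on $(\mathbb{C}^2)^{\otimes N}$, where $X_n,Y_n,Z_n$ are the Pauli operators acting on spin $n$, and the control Hamiltonian $H_c=Z_k$ for one $k\in\{1,\dots,N\}$. Let $\mathcal{H}_1$ be the $N$-dimensional single excitation subspace, spanned by the basis states in which exactly one spin is down; it is invariant under $H_s$ and $H_c$. The system is called controllable on $\mathcal{H}_1$ if the real Lie algebra generated by $iH_s|_{\mathcal{H}_1}$ and $iH_c|_{\mathcal{H}_1}$ equals $\mathfrak{u}(N)$ or $\mathfrak{su}(N)$. It has an external symmetry on $\mathcal{H}_1$ if some Hermitian operator on $\mathcal{H}_1$ that is not a multiple of the identity commutes with both $H_s|_{\mathcal{H}_1}$ and $H_c|_{\mathcal{H}_1}$. Then the system is controllable on $\mathcal{H}_1$ if and only if $\gcd(N,2k-1)=1$.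 Moreover, it has no external symmetry on $\mathcal{H}_1$ if and only if $\gcd(N,2k-1)=1$. -/

import Mathlib

open scoped Matrix

namespace SpinChain

noncomputable section

attribute [local instance 100] LieRing.ofAssociativeRing

/-- The Pauli matrix `X`; index `0` is spin up, index `1` is spin down. -/
def pauliX : Matrix (Fin 2) (Fin 2) ℂ := !![0, 1; 1, 0]

/-- The Pauli matrix `Y`. -/
def pauliY : Matrix (Fin 2) (Fin 2) ℂ := !![0, -Complex.I; Complex.I, 0]

/-- The Pauli matrix `Z`. -/
def pauliZ : Matrix (Fin 2) (Fin 2) ℂ := !![1, 0; 0, -1]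

/-- Spin configurations of `N` spins: they index the standard basis of the `N`-fold tensor
power of `ℂ²`. -/
abbrev Config (N : ℕ) : Type := Fin N → Fin 2

/-- The matrix of the tensor product `A₀ ⊗ A₁ ⊗ ⋯` of one-spin operators. -/
def tensor {N : ℕ} (A : Fin N → Matrix (Fin 2) (Fin 2) ℂ) : Matrix (Config N) (Config N) ℂ :=
  Matrix.of fun s t => ∏ i, A i (s i) (t i)

/-- The operator `A` acting on spin `n`: the tensor product whose `n`-th factor is `A`, all
other factors being the identity. -/
def site {N : ℕ} (A : Matrix (Fin 2) (Fin 2) ℂ) (n : Fin N) : Matrix (Config N) (Config N) ℂ :=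
  tensor (Function.update (fun _ => 1) n A)

/-- The Hamiltonian `½ ∑_{m<n} γ_{mn} (X_m X_n + Y_m Y_n + κ Z_m Z_n)` of a network of `N` spins
with XXZ coupling. -/
def xxzHamiltonian {N : ℕ} (γ : Fin N → Fin N → ℝ) (κ : ℝ) : Matrix (Config N) (Config N) ℂ :=
  (1 / 2 : ℂ) • ∑ m : Fin N, ∑ n : Fin N,
    if m < n then
      (γ m n : ℂ) • (site pauliX m * site pauliX n + site pauliY m * site pauliY n
        + (κ : ℂ) • (site pauliZ m * site pauliZ n))
    else 0

/-- The couplings of a chain with uniform nearest-neighbour coupling strength `g`. -/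
def chainCoupling (N : ℕ) (g : ℝ) : Fin N → Fin N → ℝ := fun m n =>
  if m.val + 1 = n.val ∨ n.val + 1 = m.val then g else 0

/-- The Hamiltonian of a uniform Heisenberg chain (`κ = 1`) of length `N`. -/
def heisenbergChain (N : ℕ) (g : ℝ) : Matrix (Config N) (Config N) ℂ :=
  xxzHamiltonian (chainCoupling N g) 1

/-- Tensor products of one-spin operators multiply factor by factor. -/
theorem tensor_mul {N : ℕ} (A B : Fin N → Matrix (Fin 2) (Fin 2) ℂ) :
    tensor A * tensor B = tensor fun i => A i * B i := by
  ext s t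
  simp only [Matrix.mul_apply, tensor, Matrix.of_apply, ← Finset.prod_mul_distrib]
  rw [Fintype.prod_sum]

/-- Matrix entries of a product of one-spin operators at two different spins. -/
theorem site_mul_site_apply {N : ℕ} (A B : Matrix (Fin 2) (Fin 2) ℂ) {m n : Fin N} (h : m ≠ n)
    (s t : Config N) :
    (site A m * site B n) s t =
      if ∀ i, i ≠ m → i ≠ n → s i = t i then A (s m) (t m) * B (s n) (t n) else 0 := by
  rw [site, site, tensor_mul, tensor, Matrix.of_apply]
  split_ifs with hs
  · rw [← Finset.prod_subset (Finset.subset_univ {m, n})]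
    · rw [Finset.prod_pair h]
      simp [h, h.symm]
    · intro i _ hi
      simp only [Finset.mem_insert, Finset.mem_singleton, not_or] at hi
      simp [hi.1, hi.2, hs i hi.1 hi.2]
  · push Not at hs
    obtain ⟨i, h1, h2, h3⟩ := hs
    exact Finset.prod_eq_zero (Finset.mem_univ i) (by simp [h1, h2, h3])

/-- An XXZ Hamiltonian conserves the number of excitations; in particular it leaves the single
excitation subspace invariant. -/
theorem xxzHamiltonian_apply_eq_zero {N : ℕ} (γ : Fin N → Fin N → ℝ) (κ : ℝ) {s t : Config N}
    (hst : ∑ i, (s i).val ≠ ∑ i, (t i).val) : xxzHamiltonian γ κ s t = 0 := by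
  simp only [xxzHamiltonian, Matrix.smul_apply, Matrix.sum_apply]
  rw [Finset.sum_eq_zero, smul_zero]
  intro m _
  refine Finset.sum_eq_zero fun n _ => ?_
  split_ifs with hmn
  · simp only [Matrix.smul_apply, Matrix.add_apply, site_mul_site_apply _ _ hmn.ne]
    split_ifs with hs
    · have key : (s m).val + (s n).val ≠ (t m).val + (t n).val := by
        intro h
        apply hst
        rw [← Finset.sum_sdiff (Finset.subset_univ {m, n}),
          ← Finset.sum_sdiff (Finset.subset_univ {m, n}), Finset.sum_pair hmn.ne,
          Finset.sum_pair hmn.ne, h]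
        congr 1
        refine Finset.sum_congr rfl fun i hi => ?_
        simp only [Finset.mem_sdiff, Finset.mem_univ, Finset.mem_insert, Finset.mem_singleton,
          true_and, not_or] at hi
        rw [hs i hi.1 hi.2]
      revert key
      generalize s m = a, s n = b, t m = c, t n = d
      fin_cases a <;> fin_cases b <;> fin_cases c <;> fin_cases d <;>
        simp [pauliX, pauliY, pauliZ]
    · simp
  · rfl

/-- The operator `Z_k` is diagonal, hence leaves every excitation subspace invariant. -/
theorem siteZ_apply_eq_zero {N : ℕ} (k : Fin N) {s t : Config N} (h : s ≠ t) :
    site pauliZ k s t = 0 := by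
  obtain ⟨i, hi⟩ := Function.ne_iff.1 h
  rw [site, tensor, Matrix.of_apply]
  refine Finset.prod_eq_zero (Finset.mem_univ i) ?_
  rcases eq_or_ne i k with rfl | hik
  · revert hi
    generalize s i = a, t i = b
    fin_cases a <;> fin_cases b <;> simp [pauliZ]
  · simp [hik, hi]

/-- The configuration in which spin `n` is down and all other spins are up. These
configurations index the basis `|1⟩, …, |N⟩` of the single excitation subspace. -/
def excitation {N : ℕ} (n : Fin N) : Config N := Pi.single n 1

/-- The matrix, in the basis `|1⟩, …, |N⟩`, of the restriction to the single excitation subspace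
of an operator that leaves this subspace invariant. -/
def restrictOne {N : ℕ} (H : Matrix (Config N) (Config N) ℂ) : Matrix (Fin N) (Fin N) ℂ :=
  H.submatrix excitation excitation

/-- The real Lie algebra `𝔲(N)` of skew-Hermitian matrices. -/
def lieU (N : ℕ) : LieSubalgebra ℝ (Matrix (Fin N) (Fin N) ℂ) where
  carrier := {A | Aᴴ = -A}
  zero_mem' := by simp
  add_mem' := by
    intro A B hA hB
    simp only [Set.mem_ofPred_eq] at hA hB ⊢
    rw [Matrix.conjTranspose_add, hA, hB, neg_add]
  smul_mem' := by
    intro c A hA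
    simp only [Set.mem_ofPred_eq] at hA ⊢
    rw [Matrix.conjTranspose_smul, hA, star_trivial, smul_neg]
  lie_mem' := by
    intro A B hA hB
    change Aᴴ = -A at hA
    change Bᴴ = -B at hB
    change (⁅A, B⁆)ᴴ = -⁅A, B⁆
    rw [Ring.lie_def, Matrix.conjTranspose_sub, Matrix.conjTranspose_mul,
      Matrix.conjTranspose_mul, hA, hB]
    noncomm_ring

/-- The real Lie algebra `𝔰𝔲(N)` of skew-Hermitian matrices of trace zero. -/
def lieSU (N : ℕ) : LieSubalgebra ℝ (Matrix (Fin N) (Fin N) ℂ) where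
  carrier := {A | Aᴴ = -A ∧ A.trace = 0}
  zero_mem' := by simp
  add_mem' := by
    rintro A B ⟨hA, hA'⟩ ⟨hB, hB'⟩
    exact ⟨(lieU N).add_mem hA hB, by rw [Matrix.trace_add, hA', hB', add_zero]⟩
  smul_mem' := by
    rintro c A ⟨hA, hA'⟩
    exact ⟨(lieU N).smul_mem c hA, by rw [Matrix.trace_smul, hA', smul_zero]⟩
  lie_mem' := by
    rintro A B ⟨hA, _⟩ ⟨hB, _⟩
    refine ⟨(lieU N).lie_mem hA hB, ?_⟩
    rw [Ring.lie_def, Matrix.trace_sub, Matrix.trace_mul_comm, sub_self]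

/-- The dynamical Lie algebra, on the single excitation subspace, of the controlled system
`Hs + f(t) Hc`: the real Lie algebra generated by `i Hs` and `i Hc`, both restricted to this
subspace. -/
def dynamicalLieAlgebra {N : ℕ} (Hs Hc : Matrix (Config N) (Config N) ℂ) :
    LieSubalgebra ℝ (Matrix (Fin N) (Fin N) ℂ) :=
  LieSubalgebra.lieSpan ℝ (Matrix (Fin N) (Fin N) ℂ)
    {Complex.I • restrictOne Hs, Complex.I • restrictOne Hc}

/-- Controllability on the single excitation subspace: the dynamical Lie algebra on this
subspace is `𝔲(N)` or `𝔰𝔲(N)`. -/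
def IsControllableOne {N : ℕ} (Hs Hc : Matrix (Config N) (Config N) ℂ) : Prop :=
  dynamicalLieAlgebra Hs Hc = lieU N ∨ dynamicalLieAlgebra Hs Hc = lieSU N

/-- The controlled system has an external symmetry on the single excitation subspace: a
Hermitian matrix, not a multiple of the identity, commutes with both restricted Hamiltonians. -/
def HasSymmetryOne {N : ℕ} (Hs Hc : Matrix (Config N) (Config N) ℂ) : Prop :=
  ∃ S : Matrix (Fin N) (Fin N) ℂ, S.IsHermitian ∧ (∀ c : ℂ, S ≠ c • 1) ∧
    Commute (restrictOne Hs) S ∧ Commute (restrictOne Hc) S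

end

end SpinChain

open scoped Matrix

namespace SpinChain

noncomputable section

attribute [local instance 100] LieRing.ofAssociativeRing

/-! On the single excitation subspace the chain is a multiple of the identity minus `g` times the
Laplacian of the path graph, and `Z_k = 1 - 2 E_kk`. With spins numbered from `0`, everything
reduces to one fact: some eigenvector of the path Laplacian vanishes at `k` iff `gcd(N, 2k+1) ≠ 1`.

For this fact, extend an eigenvector to a wave on `ℤ`. The free ends make it symmetric about `-1/2`
and `N - 1/2`, and a zero at `k` makes it antisymmetric about `k`. Composing reflections gives
period `2N` and antiperiod `2k+1`, which under coprimality force it to vanish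
(`IsWave.eq_zero_of_coprime`). If `d = gcd(N, 2k+1) > 1`, a cosine of momentum `π/d` is such an
eigenvector.

If no eigenvector vanishes at `k`, then `e_k` is cyclic for `H`, and brackets of `iH` with `iE_kk`
produce all of `𝔲(N)` (`lieU_le_of_cyclic`). Since `iE_kk` is a generator only up to the centre,
this first gives `𝔲(N)` modulo `i·1`; brackets then recover `𝔰𝔲(N)`, and a generator of nonzero
trace the rest. Only scalars commute with `𝔲(N)`, so there is no symmetry.

If an eigenvector `v` vanishes at `k`, the matrix `v vᵀ` is a symmetry, which also excludes
controllability. -/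

/-! ### Restriction to the single excitation subspace. -/

theorem excitation_apply {N : ℕ} (i m : Fin N) :
    excitation i m = if i = m then 1 else 0 := by
  simp [excitation, Pi.single_apply, eq_comm]

theorem excitation_injective {N : ℕ} : Function.Injective (excitation (N := N)) := by
  intro i j h
  have := congrFun h i
  by_contra hij
  simp [excitation_apply, Ne.symm hij] at this

theorem forall_excitation_eq_iff {N : ℕ} {m n : Fin N} (i j : Fin N) :
    (∀ l, l ≠ m → l ≠ n → excitation i l = excitation j l) ↔
      i = j ∨ ((i = m ∨ i = n) ∧ (j = m ∨ j = n)) := by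
  constructor
  · intro h
    by_contra! hc
    obtain ⟨hij, hc⟩ := hc
    have hi := h i
    have hj := h j
    simp only [excitation_apply, hij, Ne.symm hij, if_true, if_false] at hi hj
    grind
  · rintro (rfl | ⟨hi, hj⟩) l hm hn
    · rfl
    · simp only [excitation_apply]
      grind

/-- A Heisenberg bond between two spins acts on the single excitation subspace as the identity
minus twice the Laplacian of the bond. -/
theorem bond_excitation {N : ℕ} {m n : Fin N} (h : m ≠ n) (i j : Fin N) :
    (site pauliX m * site pauliX n + site pauliY m * site pauliY n
        + site pauliZ m * site pauliZ n) (excitation i) (excitation j) =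
      (if i = j then 1 else 0) - 2 * (((if i = m then 1 else 0) - (if i = n then 1 else 0)) *
        ((if j = m then 1 else 0) - (if j = n then 1 else 0)) : ℂ) := by
  simp only [Matrix.add_apply, site_mul_site_apply _ _ h, forall_excitation_eq_iff]
  simp only [excitation_apply]
  by_cases him : i = m <;> by_cases hin : i = n <;> by_cases hjm : j = m <;>
    by_cases hjn : j = n <;> by_cases hij : i = j <;>
    simp_all [pauliX, pauliY, pauliZ] <;> norm_num

theorem restrictOne_siteZ {N : ℕ} (k : Fin N) :
    restrictOne (site pauliZ k) = 1 - (2 : ℂ) • Matrix.single k k 1 := by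
  ext i j
  simp only [restrictOne, Matrix.submatrix_apply, Matrix.sub_apply, Matrix.smul_apply]
  rcases eq_or_ne i j with rfl | hij
  · rw [site, tensor, Matrix.of_apply, Finset.prod_eq_single k]
    · rcases eq_or_ne i k with rfl | hik
      · simp [excitation_apply, pauliZ]; norm_num
      · simp [excitation_apply, pauliZ, hik, Ne.symm hik]
    · intro b _ hb
      simp [hb]
    · simp
  · rw [siteZ_apply_eq_zero _ (fun h => hij (excitation_injective h))]
    rw [Matrix.single_apply_of_ne]
    · simp [hij]
    · rintro ⟨rfl, rfl⟩; exact hij rfl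

/-- Assembles the rank-one bond Laplacians into a graph Laplacian. Symmetry of `G` is not assumed,
because the weights it is used for are cut off to `m < n`. -/
theorem sum_sum_indicator_sub_mul {ι R : Type*} [Fintype ι] [DecidableEq ι] [CommRing R]
    (G : ι → ι → R) (i j : ι) :
    ∑ m, ∑ n, ((if i = m then 1 else 0) - (if i = n then 1 else 0)) *
        ((if j = m then 1 else 0) - (if j = n then 1 else 0)) * G m n =
      (if i = j then ∑ n, (G i n + G n i) else 0) - (G i j + G j i) := by
  have h : ∀ m n, ((if i = m then 1 else 0) - (if i = n then 1 else 0)) *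
        ((if j = m then 1 else 0) - (if j = n then 1 else 0)) * G m n =
      (if i = m then (if j = m then G m n else 0) else 0)
        + (if i = n then (if j = n then G m n else 0) else 0)
        - (if i = m then (if j = n then G m n else 0) else 0)
        - (if j = m then (if i = n then G m n else 0) else 0) := by
    intro m n
    split_ifs <;> ring
  simp only [h, Finset.sum_sub_distrib, Finset.sum_add_distrib, Finset.sum_ite_eq, Finset.mem_univ,
    if_true, Finset.sum_ite_irrel, Finset.sum_const_zero]
  rcases eq_or_ne i j with rfl | hij
  · simp; ring
  · simp [hij, hij.symm]; ring

/-- Entries of an isotropic (`κ = 1`) network Hamiltonian on the single excitation subspace: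
a multiple of the identity minus the weighted graph Laplacian. -/
theorem restrictOne_xxzHamiltonian_apply {N : ℕ} (γ : Fin N → Fin N → ℝ)
    (hsymm : ∀ m n, γ m n = γ n m) (hdiag : ∀ m, γ m m = 0) (i j : Fin N) :
    restrictOne (xxzHamiltonian γ 1) i j =
      (if i = j then (1 / 2 * ∑ m, ∑ n, (if m < n then γ m n else 0) - ∑ n, γ i n : ℝ) else 0 : ℂ)
        + γ i j := by
  have key : restrictOne (xxzHamiltonian γ 1) i j =
      ∑ m, ∑ n, ((if i = j then 1 else 0) * (1 / 2 * (if m < n then (γ m n : ℂ) else 0)) -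
        (((if i = m then 1 else 0) - (if i = n then 1 else 0)) *
        ((if j = m then 1 else 0) - (if j = n then 1 else 0)) : ℂ) *
          (if m < n then (γ m n : ℂ) else 0)) := by
    simp only [restrictOne, Matrix.submatrix_apply, xxzHamiltonian, Matrix.smul_apply,
      Matrix.sum_apply, Complex.ofReal_one, one_smul, smul_eq_mul, Finset.mul_sum]
    refine Finset.sum_congr rfl fun m _ => Finset.sum_congr rfl fun n _ => ?_
    split_ifs with hmn
    all_goals first
      | (rw [Matrix.smul_apply, bond_excitation hmn.ne]
         simp_all
         try ring)
      | simp
  have hG : ∀ a b, (if a < b then (γ a b : ℂ) else 0) + (if b < a then (γ b a : ℂ) else 0)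
      = γ a b := by
    intro a b
    rcases lt_trichotomy a b with h | rfl | h
    · simp [h, h.not_gt]
    · simp [hdiag]
    · simp [h, h.not_gt, hsymm a b]
  rw [key]
  simp only [Finset.sum_sub_distrib, sum_sum_indicator_sub_mul, ← Finset.mul_sum, hG]
  push_cast [apply_ite Complex.ofReal]
  split_ifs <;> ring

/-! ### The uniform chain as a path Laplacian. -/

theorem chainCoupling_symm (N : ℕ) (g : ℝ) (m n : Fin N) :
    chainCoupling N g m n = chainCoupling N g n m := by
  simp only [chainCoupling, or_comm]

theorem chainCoupling_self (N : ℕ) (g : ℝ) (m : Fin N) : chainCoupling N g m m = 0 := by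
  simp [chainCoupling]

/-- The energy shift relating the Heisenberg chain on the single excitation subspace to the
Laplacian of the path graph. -/
def chainShift (N : ℕ) (g : ℝ) : ℝ :=
  1 / 2 * ∑ m, ∑ n, if m < n then chainCoupling N g m n else 0

theorem restrictOne_heisenbergChain_apply (N : ℕ) (g : ℝ) (i j : Fin N) :
    restrictOne (heisenbergChain N g) i j =
      (if i = j then (chainShift N g - ∑ n, chainCoupling N g i n : ℝ) else 0 : ℂ)
        + chainCoupling N g i j := by
  rw [heisenbergChain, restrictOne_xxzHamiltonian_apply _ (chainCoupling_symm N g)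
    (chainCoupling_self N g), chainShift]

theorem restrictOne_heisenbergChain_transpose (N : ℕ) (g : ℝ) :
    (restrictOne (heisenbergChain N g))ᵀ = restrictOne (heisenbergChain N g) := by
  ext i j
  rw [Matrix.transpose_apply, restrictOne_heisenbergChain_apply, restrictOne_heisenbergChain_apply,
    chainCoupling_symm N g j i]
  rcases eq_or_ne i j with rfl | hij
  · rfl
  · simp [hij, hij.symm]

theorem restrictOne_heisenbergChain_isHermitian (N : ℕ) (g : ℝ) :
    (restrictOne (heisenbergChain N g)).IsHermitian := by
  ext i j
  rw [Matrix.conjTranspose_apply, ← Matrix.transpose_apply (restrictOne _),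
    restrictOne_heisenbergChain_transpose, restrictOne_heisenbergChain_apply]
  split_ifs <;> simp

theorem sum_chainCoupling_mul (N : ℕ) (g : ℝ) (i : Fin N) (u : ℤ → ℂ) :
    ∑ n : Fin N, (chainCoupling N g i n : ℂ) * u n =
      g * ((if i.val + 1 < N then u (i + 1) else 0) + (if 0 < i.val then u (i - 1) else 0)) := by
  have h : ∀ n : Fin N, (chainCoupling N g i n : ℂ) * u n =
      g * ((if i.val + 1 = n.val then u n else 0) + (if n.val + 1 = i.val then u n else 0)) := by
    intro n
    simp only [chainCoupling]
    by_cases h1 : i.val + 1 = n.val <;> by_cases h2 : n.val + 1 = i.val <;> simp [h1, h2]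
    omega
  rw [Finset.sum_congr rfl fun n _ => h n, ← Finset.mul_sum, Finset.sum_add_distrib]
  congr 2
  · split_ifs with hi
    · rw [Finset.sum_eq_single ⟨i + 1, hi⟩]
      · simp
      · intro b _ hb
        rw [if_neg]
        rintro h
        exact hb (Fin.ext h.symm)
      · simp
    · refine Finset.sum_eq_zero fun n _ => if_neg ?_
      omega
  · split_ifs with hi
    · rw [Finset.sum_eq_single ⟨i - 1, by omega⟩]
      · simp only
        rw [if_pos (by omega)]
        congr 1
        omega
      · intro b _ hb
        rw [if_neg]
        rintro h
        exact hb (Fin.ext (by simp; omega))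
      · simp
    · refine Finset.sum_eq_zero fun n _ => if_neg ?_
      omega

/-- The action of the Heisenberg chain on the single excitation subspace. -/
theorem restrictOne_heisenbergChain_mulVec (N : ℕ) (g : ℝ) (u : ℤ → ℂ) (i : Fin N) :
    (restrictOne (heisenbergChain N g) *ᵥ fun n : Fin N => u n) i =
      chainShift N g * u i + g * ((if i.val + 1 < N then u (i + 1) - u i else 0)
        + (if 0 < i.val then u (i - 1) - u i else 0)) := by
  have h1 := sum_chainCoupling_mul N g i u
  -- The constant function `1` gives the weighted degree of `i`, which is the diagonal term.
  have h2 := sum_chainCoupling_mul N g i 1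
  simp only [Pi.one_apply, mul_one] at h2
  simp only [Matrix.mulVec, dotProduct, restrictOne_heisenbergChain_apply, add_mul,
    Finset.sum_add_distrib, ite_mul, zero_mul, Finset.sum_ite_eq, Finset.mem_univ, if_true]
  push_cast
  rw [h1, h2]
  split_ifs <;> ring

/-! ### Waves on `ℤ` and their reflections. -/

/-- Bi-infinite solutions of the eigenvalue equation of the path Laplacian. -/
def IsWave (μ : ℂ) (w : ℤ → ℂ) : Prop := ∀ j, w (j - 1) + w (j + 1) = μ * w j

theorem IsWave.ext {μ : ℂ} {w w' : ℤ → ℂ} (hw : IsWave μ w) (hw' : IsWave μ w') (a : ℤ)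
    (h0 : w a = w' a) (h1 : w (a + 1) = w' (a + 1)) : w = w' := by
  have key : ∀ n : ℤ, w (a + n) = w' (a + n) ∧ w (a + n + 1) = w' (a + n + 1) := by
    intro n
    induction n using Int.induction_on with
    | zero => simpa using ⟨h0, h1⟩
    | succ n ih =>
      have e1 := hw (a + n + 1)
      have e2 := hw' (a + n + 1)
      rw [add_sub_cancel_right] at e1 e2
      rw [← add_assoc]
      exact ⟨ih.2, by linear_combination e1 - e2 - ih.1 + μ * ih.2⟩
    | pred n ih =>
      have e1 := hw (a + -n)
      have e2 := hw' (a + -n)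
      rw [← add_sub_assoc, sub_add_cancel]
      exact ⟨by linear_combination e1 - e2 - ih.2 + μ * ih.1, ih.1⟩
  funext j
  simpa using (key (j - a)).1

theorem IsWave.comp_sub {μ : ℂ} {w : ℤ → ℂ} (hw : IsWave μ w) (a : ℤ) :
    IsWave μ fun j => w (a - j) := by
  intro j
  have := hw (a - j)
  change w (a - (j - 1)) + w (a - (j + 1)) = μ * w (a - j)
  rw [show a - (j - 1) = a - j + 1 by ring, show a - (j + 1) = a - j - 1 by ring, add_comm, this]

theorem IsWave.neg {μ : ℂ} {w : ℤ → ℂ} (hw : IsWave μ w) : IsWave μ fun j => -w j := by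
  intro j
  linear_combination -hw j

/-- A solution taking equal values at `a` and `a + 1` is symmetric about the midpoint. -/
theorem IsWave.reflect {μ : ℂ} {w : ℤ → ℂ} (hw : IsWave μ w) {a : ℤ} (h : w a = w (a + 1))
    (j : ℤ) : w (2 * a + 1 - j) = w j := by
  refine congrFun (IsWave.ext (hw.comp_sub (2 * a + 1)) hw a ?_ ?_) j
  · rw [h]; congr 1; ring
  · rw [← h]; congr 1; ring

/-- A solution vanishing at `a` is antisymmetric about `a`. -/
theorem IsWave.reflect_neg {μ : ℂ} {w : ℤ → ℂ} (hw : IsWave μ w) {a : ℤ} (h : w a = 0)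
    (j : ℤ) : w (2 * a - j) = -w j := by
  refine congrFun (IsWave.ext (hw.comp_sub (2 * a)) hw.neg a ?_ ?_) j
  · simp [two_mul, h]
  · have := hw a
    rw [show 2 * a - (a + 1) = a - 1 by ring]
    linear_combination this + μ * h

/-- Products of two reflections are translations: the two symmetries give period `2N`, and a
symmetry with the antisymmetry gives antiperiod `2k+1`, hence period `2(2k+1)`. By Bézout `2` is a
period. -/
theorem IsWave.eq_zero_of_coprime {μ : ℂ} {w : ℤ → ℂ} (hw : IsWave μ w) {N k : ℤ}
    (h0 : w (-1) = w 0) (hN : w (N - 1) = w N) (hk : w k = 0) (hc : IsCoprime N (2 * k + 1)) :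
    w = 0 := by
  have r0 : ∀ j, w (-1 - j) = w j := fun j => by
    simpa using hw.reflect (a := -1) (by simpa using h0) j
  have rN : ∀ j, w (2 * N - 1 - j) = w j := fun j => by
    rw [← hw.reflect (a := N - 1) (by simpa using hN) j]
    congr 1; ring
  have rk := hw.reflect_neg hk
  have p1 : Function.Periodic w (2 * N) := fun j => by
    rw [← r0 j, ← rN (-1 - j)]
    congr 1; ring
  have p2 : Function.Antiperiodic w (2 * k + 1) := fun j => by
    rw [← r0 j, ← rk (-1 - j)]
    congr 1; ring
  have p3 : Function.Periodic w 2 := by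
    obtain ⟨a, b, hab⟩ := hc
    have := (p1.int_mul a).add_period (p2.periodic_two_mul.int_mul b)
    simp only [Int.cast_id] at this
    rwa [show a * (2 * N) + b * (2 * (2 * k + 1)) = 2 by linear_combination 2 * hab] at this
  -- The antiperiod carries `-1` to `2k`, so `w (2k) = -w (-1)`; period `2` and the left end give `w
  -- (2k) = w 0 = w (-1)`.
  have z : w 0 = 0 := by
    have h1 := p2 (-1)
    have h2 := (p3.int_mul k) 0
    rw [show -1 + (2 * k + 1) = 0 + k * 2 by ring] at h1
    simp only [Int.cast_id] at h2
    rw [h2, h0] at h1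
    exact self_eq_neg.1 h1
  refine IsWave.ext hw (fun j => by simp) (-1) ?_ ?_
  · simpa [h0] using z
  · simpa using z

/-- The solution with the boundary condition of a free end to the left of `0`. -/
theorem exists_isWave (μ a : ℂ) : ∃ w, IsWave μ w ∧ w (-1) = a ∧ w 0 = a := by
  -- `U_j - U_{j-1}` equals `1` at both `j = -1` and `j = 0`, since `U_{-2} = -1`, `U_{-1} = 0` and
  -- `U_0 = 1`.
  refine ⟨fun j => a * ((Polynomial.Chebyshev.U ℂ j).eval (μ / 2)
    - (Polynomial.Chebyshev.U ℂ (j - 1)).eval (μ / 2)), fun j => ?_, ?_, ?_⟩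
  · have h1 := congrArg (Polynomial.eval (μ / 2)) (Polynomial.Chebyshev.U_add_one ℂ j)
    have h2 := congrArg (Polynomial.eval (μ / 2)) (Polynomial.Chebyshev.U_add_one ℂ (j - 1))
    simp only [Polynomial.eval_sub, Polynomial.eval_mul, Polynomial.eval_X, Polynomial.eval_ofNat,
      sub_add_cancel] at h1 h2
    simp only [add_sub_cancel_right]
    linear_combination a * h1 - a * h2
  · have : (-1 - 1 : ℤ) = -2 := rfl
    simp [this]
  · simp

/-- The end conditions make the differences across the missing bonds zero, so the wave equation
holds at every site of the chain. -/
theorem restrictOne_heisenbergChain_mulVec_isWave {N : ℕ} (g : ℝ) {μ : ℂ} {w : ℤ → ℂ}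
    (hw : IsWave μ w) (h0 : w (-1) = w 0) (hN : w (N - 1) = w N) :
    (restrictOne (heisenbergChain N g) *ᵥ fun n : Fin N => w n) =
      (chainShift N g + g * (μ - 2)) • fun n : Fin N => w n := by
  funext i
  rw [restrictOne_heisenbergChain_mulVec]
  have h := hw i
  have e1 : (if i.val + 1 < N then w (i + 1) - w i else 0) = w (i + 1) - w i := by
    split_ifs with hi
    · rfl
    · have : (i.val : ℤ) = N - 1 := by omega
      rw [this, sub_add_cancel, hN, sub_self]
  have e2 : (if 0 < i.val then w (i - 1) - w i else 0) = w (i - 1) - w i := by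
    split_ifs with hi
    · rfl
    · have : i.val = 0 := by omega
      simp [this, h0]
  rw [e1, e2, Pi.smul_apply, smul_eq_mul]
  linear_combination (g : ℂ) * h

/-! ### Eigenvectors vanishing at the controlled spin. -/

/-- If the position of `k` is coprime to the length, then no eigenvector of the Heisenberg chain
vanishes at `k`. -/
theorem eq_zero_of_mulVec_eq_smul {N : ℕ} {k : Fin N} {g : ℝ} (hg : g ≠ 0)
    (hc : Nat.Coprime N (2 * k + 1)) {v : Fin N → ℂ} {lam : ℂ}
    (hv : restrictOne (heisenbergChain N g) *ᵥ v = lam • v) (hk : v k = 0) : v = 0 := by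
  -- The values of `u` off the chain are arbitrary; only those on `0, …, N - 1` are used.
  obtain ⟨u, hu⟩ : ∃ u : ℤ → ℂ, v = fun n : Fin N => u n :=
    ⟨fun j => if h : j.toNat < N then v ⟨j.toNat, h⟩ else 0, by funext n; simp⟩
  subst hu
  have hg' : (g : ℂ) ≠ 0 := by exact_mod_cast hg
  obtain ⟨μ, rfl⟩ : ∃ μ : ℂ, lam = chainShift N g + g * (μ - 2) :=
    ⟨(lam - chainShift N g) / g + 2, by field_simp; ring⟩
  have heq : ∀ i : ℕ, i < N → (if i + 1 < N then u (i + 1) - u i else 0)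
      + (if 0 < i then u (i - 1) - u i else 0) = (μ - 2) * u i := by
    intro i hi
    have := congrFun hv ⟨i, hi⟩
    rw [restrictOne_heisenbergChain_mulVec, Pi.smul_apply, smul_eq_mul] at this
    refine mul_left_cancel₀ hg' ?_
    simp only at this
    linear_combination this
  -- The wave with a free left end and the same value at `0` agrees with `u` along the chain; the
  -- last row of the eigenvalue equation then gives the right end condition.
  obtain ⟨w, hw, hw1, hw0⟩ := exists_isWave μ (u 0)
  have huw : ∀ i : ℕ, i < N → u i = w i := by
    intro i
    induction i using Nat.strong_induction_on with
    | _ i ih =>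
      intro hi
      match i, ih, hi with
      | 0, _, _ => simp [hw0]
      | 1, _, hi =>
        have h1 := heq 0 (by omega)
        have h2 := hw 0
        simp [hi] at h1 h2
        simp only [Nat.cast_one]
        linear_combination h1 - h2 + hw1 + (1 - μ) * hw0 - hw0
      | i + 2, ih, hi =>
        have h1 := heq (i + 1) (by omega)
        have h2 := hw (i + 1)
        have h3 := ih i (by omega) (by omega)
        have h4 := ih (i + 1) (by omega) (by omega)
        rw [if_pos (by omega), if_pos (by omega)] at h1
        push_cast at h1 h4 ⊢
        rw [add_sub_cancel_right] at h1 h2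
        rw [add_assoc, one_add_one_eq_two] at h1 h2
        linear_combination h1 - h2 + μ * h4 - h3
  have hpos : 0 < N := k.pos
  have hN : w (N - 1) = w N := by
    have h1 := heq (N - 1) (by omega)
    have h2 := hw (N - 1)
    have h3 := huw (N - 1) (by omega)
    rw [if_neg (by omega)] at h1
    push_cast [Nat.cast_sub (show 1 ≤ N from hpos)] at h1 h3
    rw [sub_add_cancel] at h2
    split_ifs at h1 with hN
    · have h4 := huw (N - 2) (by omega)
      push_cast [Nat.cast_sub (show 2 ≤ N by omega)] at h4
      rw [sub_sub, one_add_one_eq_two] at h1 h2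
      linear_combination h1 - h2 - h4 - (1 - μ) * h3
    -- A single site is both ends at once: `(μ - 2) u 0 = 0`, and either factor may vanish.
    · obtain rfl : N = 1 := by omega
      simp at h1 h2 h3 ⊢
      rw [← h3]
      rw [hw1, ← h3] at h2
      rcases h1 with h1 | h1
      · linear_combination -h2 - u 0 * h1
      · rw [h1] at h2 ⊢
        linear_combination -h2
  have hz := hw.eq_zero_of_coprime (hw1.trans hw0.symm) hN (by rw [← huw k k.2]; exact hk)
    (by exact_mod_cast hc.isCoprime)
  funext i
  rw [huw i i.2, hz]
  rfl

/-- If the position of `k` is not coprime to the length, then some real eigenvector of the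
Heisenberg chain vanishes at `k`. -/
theorem exists_mulVec_eq_smul {N : ℕ} (k : Fin N) (g : ℝ) (hc : ¬ Nat.Coprime N (2 * k + 1)) :
    ∃ (v : Fin N → ℂ) (lam : ℂ), restrictOne (heisenbergChain N g) *ᵥ v = lam • v ∧ v k = 0 ∧
      star v = v ∧ v ≠ 0 := by
  set d := Nat.gcd N (2 * k + 1) with hd
  obtain ⟨q, hq⟩ : d ∣ N := Nat.gcd_dvd_left _ _
  obtain ⟨r, hr⟩ : d ∣ 2 * k + 1 := Nat.gcd_dvd_right _ _
  have hd1 : 1 < d := by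
    have : 0 < d := Nat.gcd_pos_of_pos_right _ (by omega)
    have : d ≠ 1 := hc
    omega
  have hd0 : (d : ℝ) ≠ 0 := by positivity
  -- Even about `-1/2`; also even about `N - 1/2` because `d ∣ N`, and zero at `k` because
  -- `(2k+1)/d` is odd.
  let f : ℤ → ℝ := fun j => Real.cos (Real.pi * (2 * j + 1) / (2 * d))
  have hf : IsWave (2 * Real.cos (Real.pi / d) : ℝ) fun j => (f j : ℂ) := by
    intro j
    suffices h : f (j - 1) + f (j + 1) = 2 * Real.cos (Real.pi / d) * f j by
      beta_reduce
      exact_mod_cast h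
    simp only [f, Int.cast_sub, Int.cast_add, Int.cast_one]
    rw [show Real.pi * (2 * ((j : ℝ) - 1) + 1) / (2 * d)
        = Real.pi * (2 * j + 1) / (2 * d) - Real.pi / d by field_simp; ring,
      show Real.pi * (2 * ((j : ℝ) + 1) + 1) / (2 * d)
        = Real.pi * (2 * j + 1) / (2 * d) + Real.pi / d by field_simp; ring,
      Real.cos_sub, Real.cos_add]
    ring
  have hf0 : f (-1) = f 0 := by
    simp only [f]
    rw [← Real.cos_neg]
    congr 1
    push_cast
    ring
  have hfN : f (N - 1) = f N := by
    have hqr : (N : ℝ) = d * q := by exact_mod_cast hq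
    simp only [f]
    push_cast
    rw [hqr, show Real.pi * (2 * ((d : ℝ) * q - 1) + 1) / (2 * d)
        = q * Real.pi - Real.pi / (2 * d) by field_simp; ring,
      show Real.pi * (2 * ((d : ℝ) * q) + 1) / (2 * d)
        = q * Real.pi + Real.pi / (2 * d) by field_simp,
      Real.cos_sub, Real.cos_add, Real.sin_nat_mul_pi]
    ring
  have hfk : f k = 0 := by
    have hrr : (2 * (k.val : ℝ) + 1) = d * r := by exact_mod_cast hr
    obtain ⟨s, hs⟩ : Odd r := Nat.Odd.of_mul_right (m := d) (n := r) (hr ▸ ⟨k, rfl⟩)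
    simp only [f, Int.cast_natCast]
    rw [hrr, Real.cos_eq_zero_iff]
    refine ⟨s, ?_⟩
    rw [hs]
    push_cast
    field_simp
  refine ⟨_, _, restrictOne_heisenbergChain_mulVec_isWave g hf (by exact_mod_cast hf0)
    (by exact_mod_cast hfN), by exact_mod_cast hfk, ?_, fun h => ?_⟩
  · funext i
    simp
  · have h0 := congrFun h ⟨0, k.pos⟩
    have hd1' : (1 : ℝ) < d := by exact_mod_cast hd1
    -- `f 0 = cos (π / (2d))` is positive precisely because `d > 1`.
    have : 0 < f 0 := by
      simp only [f]
      apply Real.cos_pos_of_mem_Ioo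
      constructor
      · have : 0 < Real.pi * (2 * ((0 : ℤ) : ℝ) + 1) / (2 * d) := by
          simp; positivity
        linarith [Real.pi_pos]
      · simp only [Int.cast_zero, mul_zero, zero_add, mul_one]
        apply div_lt_div_of_pos_left Real.pi_pos (by norm_num)
        linarith
    simp at h0
    exact this.ne' h0

/-! ### Brackets of the matrices `u v* - v u*`. -/

/-- The skew-Hermitian matrix `u v* - v u*`. -/
def skewPair {N : ℕ} (u v : Fin N → ℂ) : Matrix (Fin N) (Fin N) ℂ :=
  Matrix.vecMulVec u (star v) - Matrix.vecMulVec v (star u)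

theorem skewPair_apply {N : ℕ} (u v : Fin N → ℂ) (i j : Fin N) :
    skewPair u v i j = u i * star (v j) - v i * star (u j) := rfl

theorem skewPair_add {N : ℕ} (u v w : Fin N → ℂ) :
    skewPair (u + v) w = skewPair u w + skewPair v w := by
  ext i j
  simp [skewPair_apply]
  ring

theorem single_self_eq_vecMulVec {N : ℕ} (k : Fin N) : Matrix.single k k (1 : ℂ) =
    Matrix.vecMulVec (Pi.single k 1) (star (Pi.single k 1 : Fin N → ℂ)) := by
  ext i j
  simp [Matrix.vecMulVec_apply, Matrix.single_apply, Pi.single_apply]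
  grind

/-- Modulo `iE_kk`, this bracket multiplies `u` by `-i`; it supplies the complex structure that a
real Lie algebra lacks. -/
theorem lie_diag_skewPair {N : ℕ} (k : Fin N) (u : Fin N → ℂ) :
    ⁅Complex.I • Matrix.single k k (1 : ℂ), skewPair u (Pi.single k 1)⁆ =
      (2 * (u k).re) • (Complex.I • Matrix.single k k (1 : ℂ))
        - skewPair (Complex.I • u) (Pi.single k 1) := by
  have hre : ((2 * (u k).re : ℝ) : ℂ) = u k + star (u k) := by
    simp [Complex.add_conj]
  rw [← algebraMap_smul ℂ (2 * (u k).re), Complex.coe_algebraMap, hre, single_self_eq_vecMulVec,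
    Ring.lie_def]
  simp only [skewPair, mul_sub, sub_mul, smul_mul_assoc, mul_smul_comm,
    Matrix.vecMulVec_mul_vecMulVec]
  ext i j
  simp [Matrix.vecMulVec_apply]
  ring

/-- Frees the second slot: pairs with `e_k`, together with `iE_kk`, generate the general pair of `u`
and `v`. -/
theorem lie_skewPair_skewPair {N : ℕ} (k : Fin N) (u v : Fin N → ℂ) :
    ⁅skewPair u (Pi.single k 1), skewPair v (Pi.single k 1)⁆ =
      skewPair (v k • u) (Pi.single k 1) - skewPair (u k • v) (Pi.single k 1)
        - (2 * (star u ⬝ᵥ v).im) • (Complex.I • Matrix.single k k (1 : ℂ)) - skewPair u v := by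
  have him : ((2 * (star u ⬝ᵥ v).im : ℝ) : ℂ) * Complex.I = (star u ⬝ᵥ v) - (star v ⬝ᵥ u) := by
    have : star v ⬝ᵥ u = star (star u ⬝ᵥ v) := by
      rw [Matrix.star_dotProduct]
    rw [this, Complex.star_def, Complex.sub_conj]
  rw [← algebraMap_smul ℂ (2 * (star u ⬝ᵥ v).im), Complex.coe_algebraMap, smul_smul, him,
    single_self_eq_vecMulVec, Ring.lie_def]
  simp only [skewPair, mul_sub, sub_mul, Matrix.vecMulVec_mul_vecMulVec]
  ext i j
  simp [Matrix.vecMulVec_apply]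
  ring

theorem lie_isHermitian_skewPair {N : ℕ} {H : Matrix (Fin N) (Fin N) ℂ} (hH : H.IsHermitian)
    (u v : Fin N → ℂ) :
    ⁅Complex.I • H, skewPair u v⁆ =
      skewPair (Complex.I • (H *ᵥ u)) v + skewPair u (Complex.I • (H *ᵥ v)) := by
  have hs : ∀ w : Fin N → ℂ, star w ᵥ* H = star (H *ᵥ w) := fun w => by
    rw [Matrix.star_mulVec, hH.eq]
  simp only [skewPair, Ring.lie_def, mul_sub, sub_mul, smul_mul_assoc, mul_smul_comm,
    Matrix.mul_vecMulVec, Matrix.vecMulVec_mul, hs]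
  ext i j
  simp [Matrix.vecMulVec_apply]
  ring

theorem lie_isHermitian_diag {N : ℕ} {H : Matrix (Fin N) (Fin N) ℂ} (hH : H.IsHermitian)
    (k : Fin N) :
    ⁅Complex.I • H, Complex.I • Matrix.single k k (1 : ℂ)⁆ =
      -skewPair (H *ᵥ Pi.single k 1) (Pi.single k 1) := by
  have hs : ∀ w : Fin N → ℂ, star w ᵥ* H = star (H *ᵥ w) := fun w => by
    rw [Matrix.star_mulVec, hH.eq]
  simp only [single_self_eq_vecMulVec, skewPair, Ring.lie_def, smul_mul_assoc, mul_smul_comm,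
    Matrix.mul_vecMulVec, Matrix.vecMulVec_mul, hs, smul_smul, Complex.I_mul_I]
  module

/-- A skew-Hermitian matrix is a sum of matrices `u v* - v u*`. -/
theorem eq_sum_skewPair {N : ℕ} {M : Matrix (Fin N) (Fin N) ℂ} (hM : Mᴴ = -M) :
    M = (1 / 2 : ℝ) • ∑ j, skewPair (M *ᵥ Pi.single j 1) (Pi.single j 1) := by
  ext a b
  have hab : (starRingEnd ℂ) (M b a) = -M a b := by
    rw [← Complex.star_def, ← Matrix.conjTranspose_apply, hM, Matrix.neg_apply]
  simp only [Matrix.smul_apply, Matrix.sum_apply, skewPair_apply, Finset.sum_sub_distrib]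
  simp [Pi.single_apply, apply_ite (starRingEnd ℂ), hab]
  ring

/-! ### From a cyclic vector to `𝔲(N)`. -/

/-- A subspace invariant under a complex symmetric matrix and not contained in a proper invariant
hyperplane given by an eigenvector is everything. -/
theorem eq_top_of_invariant {N : ℕ} {H : Matrix (Fin N) (Fin N) ℂ} (hH : Hᵀ = H) {e : Fin N → ℂ}
    (hcyc : ∀ (v : Fin N → ℂ) (lam : ℂ), H *ᵥ v = lam • v → e ⬝ᵥ v = 0 → v = 0)
    (W : Submodule ℂ (Fin N → ℂ)) (he : e ∈ W) (hW : ∀ u ∈ W, H *ᵥ u ∈ W) : W = ⊤ := by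
  by_contra hne
  obtain ⟨f, hf0, hf⟩ := W.exists_le_ker_of_lt_top (lt_top_iff_ne_top.2 hne)
  -- The annihilator for the bilinear product, without conjugation: it is `H`-invariant because `Hᵀ
  -- = H`, and if nonzero it contains an eigenvector annihilated by `e`.
  let W' : Submodule ℂ (Fin N → ℂ) :=
    { carrier := {y | ∀ u ∈ W, u ⬝ᵥ y = 0}
      zero_mem' := fun u _ => dotProduct_zero u
      add_mem' := fun {a b} ha hb u hu => by rw [dotProduct_add, ha u hu, hb u hu, add_zero]
      smul_mem' := fun c a ha u hu => by rw [dotProduct_smul, ha u hu, smul_zero] }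
  have hmem : ∀ y, y ∈ W' ↔ ∀ u ∈ W, u ⬝ᵥ y = 0 := fun y => Iff.rfl
  have hinv : ∀ y ∈ W', Matrix.mulVecLin H y ∈ W' := by
    intro y hy u hu
    rw [Matrix.mulVecLin_apply, Matrix.dotProduct_mulVec, ← Matrix.mulVec_transpose, hH]
    exact hy _ (hW u hu)
  have hfu : ∀ u : Fin N → ℂ, u ⬝ᵥ (fun j => f (Pi.single j 1)) = f u := by
    intro u
    conv_rhs => rw [pi_eq_sum_univ' u]
    simp [dotProduct, map_sum]
  have hnt : Nontrivial W' := by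
    refine ⟨⟨fun j => f (Pi.single j 1), fun u hu => ?_⟩, 0, fun h => hf0 ?_⟩
    · rw [hfu]
      exact hf hu
    · have h' : (fun j => f (Pi.single j 1)) = 0 := congrArg Subtype.val h
      ext u
      simpa using congrFun h' u
  obtain ⟨lam, hlam⟩ := Module.End.exists_eigenvalue ((Matrix.mulVecLin H).restrict hinv)
  obtain ⟨v, hv⟩ := hlam.exists_hasEigenvector
  refine hv.2 (Subtype.ext (hcyc v lam ?_ (v.2 e he)))
  exact congrArg Subtype.val hv.apply_eq_smul

/-- The vectors `u` with `u e_k* - e_k u*` in `K` form a complex subspace that contains `e_k` and is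
`H`-invariant, hence is everything; the pairs then span `𝔲(N)`. -/
theorem lieU_le_of_cyclic {N : ℕ} {H : Matrix (Fin N) (Fin N) ℂ} (hH : H.IsHermitian)
    (hHt : Hᵀ = H) {k : Fin N}
    (hcyc : ∀ (v : Fin N → ℂ) (lam : ℂ), H *ᵥ v = lam • v → v k = 0 → v = 0)
    (K : LieSubalgebra ℝ (Matrix (Fin N) (Fin N) ℂ)) (hHK : Complex.I • H ∈ K)
    (hPK : Complex.I • Matrix.single k k (1 : ℂ) ∈ K) : lieU N ≤ K := by
  have hI : ∀ u : Fin N → ℂ, skewPair u (Pi.single k 1) ∈ K →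
      skewPair (Complex.I • u) (Pi.single k 1) ∈ K := by
    intro u hu
    have h := K.lie_mem hPK hu
    rw [lie_diag_skewPair] at h
    have h' := K.sub_mem (K.smul_mem (2 * (u k).re) hPK) h
    rwa [sub_sub_cancel] at h'
  let W : Submodule ℂ (Fin N → ℂ) :=
    { carrier := {u | skewPair u (Pi.single k 1) ∈ K}
      zero_mem' := by
        have : skewPair 0 (Pi.single k 1 : Fin N → ℂ) = 0 := by simp [skewPair]
        simp [this]
      add_mem' := fun {a b} ha hb => by
        simp only [Set.mem_ofPred_eq, skewPair_add] at *
        exact K.add_mem ha hb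
      smul_mem' := fun c u hu => by
        have hc : skewPair (c • u) (Pi.single k 1) = c.re • skewPair u (Pi.single k 1)
            + c.im • skewPair (Complex.I • u) (Pi.single k 1) := by
          ext i j
          have h1 := Complex.re_add_im c
          have h2 := congrArg (starRingEnd ℂ) h1
          simp only [map_add, map_mul, Complex.conj_ofReal, Complex.conj_I] at h2
          simp [skewPair_apply]
          set x : ℂ := (starRingEnd ℂ) (Pi.single (M := fun _ => ℂ) k 1 j)
          linear_combination -(u i * x) * h1
            + (Pi.single (M := fun _ => ℂ) k 1 i * (starRingEnd ℂ) (u j)) * h2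
        change skewPair (c • u) (Pi.single k 1) ∈ K
        rw [hc]
        exact K.add_mem (K.smul_mem _ hu) (K.smul_mem _ (hI u hu)) }
  have hmem : ∀ u, u ∈ W ↔ skewPair u (Pi.single k 1) ∈ K := fun u => Iff.rfl
  have hpair : ∀ u ∈ W, ∀ v ∈ W, skewPair u v ∈ K := by
    intro u hu v hv
    have h := K.lie_mem ((hmem u).1 hu) ((hmem v).1 hv)
    rw [lie_skewPair_skewPair] at h
    have h' := K.sub_mem (K.sub_mem (K.sub_mem ((hmem _).1 (W.smul_mem (v k) hu))
      ((hmem _).1 (W.smul_mem (u k) hv))) (K.smul_mem (2 * (star u ⬝ᵥ v).im) hPK)) h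
    rwa [sub_sub_cancel] at h'
  have he : Pi.single k 1 ∈ W := by
    rw [hmem, skewPair, sub_self]
    exact K.zero_mem
  have hHe : H *ᵥ Pi.single k 1 ∈ W := by
    have h := K.lie_mem hHK hPK
    rw [lie_isHermitian_diag hH] at h
    exact (neg_mem_iff (S := LieSubalgebra ℝ _)).1 h
  have hWH : ∀ u ∈ W, H *ᵥ u ∈ W := by
    intro u hu
    have h := K.lie_mem hHK ((hmem u).1 hu)
    rw [lie_isHermitian_skewPair hH] at h
    -- Removes the term of the bracket in which `H` acts on `e_k`, leaving the one in which it acts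
    -- on `u`.
    have h1 := hpair u hu _ (W.smul_mem Complex.I hHe)
    have h2 : Complex.I • (H *ᵥ u) ∈ W := by
      have := K.sub_mem h h1
      rwa [add_sub_cancel_right] at this
    have h3 := W.smul_mem (-Complex.I) h2
    rwa [smul_smul, neg_mul, Complex.I_mul_I, neg_neg, one_smul] at h3
  have hW : W = ⊤ := eq_top_of_invariant hHt (e := Pi.single k 1)
    (fun v lam hv hk => hcyc v lam hv (by simpa using hk)) W he hWH
  intro M hM
  rw [eq_sum_skewPair hM]
  refine K.smul_mem _ (K.toSubmodule.sum_mem fun j _ => ?_)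
  exact hpair _ (hW ▸ Submodule.mem_top) _ (hW ▸ Submodule.mem_top)

/-! ### Removing the centre. -/

theorem mem_lieU {N : ℕ} {M : Matrix (Fin N) (Fin N) ℂ} : M ∈ lieU N ↔ Mᴴ = -M := Iff.rfl

theorem mem_lieSU {N : ℕ} {M : Matrix (Fin N) (Fin N) ℂ} :
    M ∈ lieSU N ↔ Mᴴ = -M ∧ M.trace = 0 := Iff.rfl

theorem I_smul_mem_lieU {N : ℕ} {H : Matrix (Fin N) (Fin N) ℂ} (hH : H.IsHermitian) :
    Complex.I • H ∈ lieU N := by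
  rw [mem_lieU, Matrix.conjTranspose_smul, hH.eq]
  simp

theorem single_sub_single_mem_lieU {N : ℕ} (i j : Fin N) :
    Matrix.single i j (1 : ℂ) - Matrix.single j i 1 ∈ lieU N := by
  simp [mem_lieU]

theorem isHermitian_single_self {N : ℕ} (i : Fin N) :
    (Matrix.single i i (1 : ℂ)).IsHermitian := by
  simp [Matrix.IsHermitian]

theorem isHermitian_single_add_single {N : ℕ} (i j : Fin N) :
    (Matrix.single i j (1 : ℂ) + Matrix.single j i 1).IsHermitian := by
  simp [Matrix.IsHermitian, add_comm]

/-- The Lie algebra obtained from `L` by adjoining the imaginary multiples of the identity. -/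
def adjoinCenter {N : ℕ} (L : LieSubalgebra ℝ (Matrix (Fin N) (Fin N) ℂ)) :
    LieSubalgebra ℝ (Matrix (Fin N) (Fin N) ℂ) where
  carrier := {M | ∃ c : ℝ, M + (c * Complex.I) • (1 : Matrix (Fin N) (Fin N) ℂ) ∈ L}
  zero_mem' := ⟨0, by simp⟩
  add_mem' := by
    rintro A B ⟨a, ha⟩ ⟨b, hb⟩
    refine ⟨a + b, ?_⟩
    convert L.add_mem ha hb using 1
    push_cast
    module
  smul_mem' := by
    rintro r A ⟨a, ha⟩
    refine ⟨r * a, ?_⟩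
    convert L.smul_mem r ha using 1
    rw [smul_add, ← algebraMap_smul ℂ r ((a * Complex.I) • (1 : Matrix (Fin N) (Fin N) ℂ)),
      smul_smul, Complex.coe_algebraMap]
    push_cast
    rw [mul_assoc]
  lie_mem' := by
    rintro A B ⟨a, ha⟩ ⟨b, hb⟩
    refine ⟨0, ?_⟩
    convert L.lie_mem ha hb using 1
    simp only [Ring.lie_def, Complex.ofReal_zero, zero_mul, zero_smul, add_zero, add_mul, mul_add,
      smul_mul_assoc, mul_smul_comm, one_mul, mul_one]
    module

theorem mem_adjoinCenter {N : ℕ} {L : LieSubalgebra ℝ (Matrix (Fin N) (Fin N) ℂ)}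
    {M : Matrix (Fin N) (Fin N) ℂ} : M ∈ adjoinCenter L ↔
      ∃ c : ℝ, M + (c * Complex.I) • (1 : Matrix (Fin N) (Fin N) ℂ) ∈ L := Iff.rfl

theorem le_adjoinCenter {N : ℕ} (L : LieSubalgebra ℝ (Matrix (Fin N) (Fin N) ℂ)) :
    L ≤ adjoinCenter L := fun M hM => mem_adjoinCenter.2 ⟨0, by simpa using hM⟩

theorem lie_mem_of_mem_adjoinCenter {N : ℕ} {L : LieSubalgebra ℝ (Matrix (Fin N) (Fin N) ℂ)}
    {A B : Matrix (Fin N) (Fin N) ℂ} (hA : A ∈ adjoinCenter L) (hB : B ∈ adjoinCenter L) :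
    ⁅A, B⁆ ∈ L := by
  obtain ⟨a, ha⟩ := hA
  obtain ⟨b, hb⟩ := hB
  convert L.lie_mem ha hb using 1
  simp only [Ring.lie_def, add_mul, mul_add, smul_mul_assoc, mul_smul_comm, one_mul, mul_one]
  module

/-- Exhibits the off-diagonal part as a sum of brackets. An entry `(a, b)` with `a ≠ b` is
multiplied by `-1` for `j = a` and for `j = b`, whence the factor `-1/2`; diagonal entries are
killed. -/
theorem sub_diag_eq_sum_lie {N : ℕ} (M : Matrix (Fin N) (Fin N) ℂ) :
    M = ∑ j : Fin N, M j j • Matrix.single j j (1 : ℂ) + (-1 / 2 : ℝ) • ∑ j : Fin N,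
      ⁅Complex.I • Matrix.single j j (1 : ℂ), ⁅Complex.I • Matrix.single j j (1 : ℂ), M⁆⁆ := by
  ext a b
  have h : ∀ j, ⁅Complex.I • Matrix.single j j (1 : ℂ),
      ⁅Complex.I • Matrix.single j j (1 : ℂ), M⁆⁆ a b =
      (if j = a then 2 * (if j = b then M a b else 0) else 0) - (if j = a then M a b else 0)
        - (if j = b then M a b else 0) := by
    intro j
    have hd : Matrix.single j j (1 : ℂ) = Matrix.diagonal fun i => if j = i then 1 else 0 := by
      ext x y
      simp only [Matrix.single_apply, Matrix.diagonal_apply]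
      grind
    simp only [hd, Ring.lie_def, mul_sub, sub_mul, smul_mul_assoc, mul_smul_comm, smul_smul,
      Complex.I_mul_I, smul_sub, Matrix.sub_apply, Matrix.smul_apply, Matrix.diagonal_mul,
      Matrix.mul_diagonal, smul_eq_mul]
    split_ifs <;> ring
  simp only [Matrix.add_apply, Matrix.smul_apply, Matrix.sum_apply, h, Finset.sum_sub_distrib,
    Finset.sum_ite_eq', Finset.mem_univ, if_true, Matrix.single_apply]
  rcases eq_or_ne a b with rfl | hab
  · simp
    ring
  · have : ∀ x, ¬ (x = a ∧ x = b) := fun x hx => hab (hx.1.symm.trans hx.2)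
    simp [hab, this]
    ring

/-- If `L` spans `𝔲(N)` together with the imaginary multiples of the identity, then `L` contains
every skew-Hermitian matrix up to a multiple of a fixed diagonal matrix unit. -/
theorem sub_trace_smul_single_mem {N : ℕ} {L : LieSubalgebra ℝ (Matrix (Fin N) (Fin N) ℂ)}
    (hL : lieU N ≤ adjoinCenter L) (k : Fin N) {M : Matrix (Fin N) (Fin N) ℂ} (hM : M ∈ lieU N) :
    M - M.trace • Matrix.single k k 1 ∈ L := by
  have hlie : ∀ {A B}, A ∈ lieU N → B ∈ lieU N → ⁅A, B⁆ ∈ L := fun hA hB =>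
    lie_mem_of_mem_adjoinCenter (hL hA) (hL hB)
  -- Half the bracket of `E_jk - E_kj` with `i(E_jk + E_kj)`.
  have hd : ∀ j, Complex.I • (Matrix.single j j (1 : ℂ) - Matrix.single k k 1) ∈ L := by
    intro j
    rcases eq_or_ne j k with rfl | hjk
    · simp
    · have h := L.smul_mem (1 / 2 : ℝ) (hlie (single_sub_single_mem_lieU j k)
        (I_smul_mem_lieU (isHermitian_single_add_single j k)))
      convert h using 1
      ext a b
      simp [Ring.lie_def, mul_add, add_mul, mul_sub, sub_mul, Matrix.single_mul_single_of_ne,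
        hjk, hjk.symm, Matrix.single_apply]
      split_ifs <;> ring
  have hdiag : ∀ j, M j j • (Matrix.single j j (1 : ℂ) - Matrix.single k k 1) ∈ L := by
    intro j
    have h1 : star (M j j) = - M j j := by
      rw [← Matrix.conjTranspose_apply, mem_lieU.1 hM, Matrix.neg_apply]
    have h2 : M j j = (M j j).im * Complex.I := by
      apply Complex.ext
      · have := congrArg Complex.re h1
        simp at this ⊢
        linarith
      · simp
    rw [h2, mul_smul, ← Complex.coe_algebraMap, algebraMap_smul]
    exact L.smul_mem _ (hd j)
  have h : M - M.trace • Matrix.single k k 1 =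
      ∑ j : Fin N, M j j • (Matrix.single j j (1 : ℂ) - Matrix.single k k 1) + (-1 / 2 : ℝ) • ∑ j : Fin N,
      ⁅Complex.I • Matrix.single j j (1 : ℂ), ⁅Complex.I • Matrix.single j j (1 : ℂ), M⁆⁆ := by
    have ht : ∑ j : Fin N, M j j • (Matrix.single j j (1 : ℂ) - Matrix.single k k 1) =
        ∑ j : Fin N, M j j • Matrix.single j j (1 : ℂ) - M.trace • Matrix.single k k 1 := by
      simp only [smul_sub, Finset.sum_sub_distrib, ← Finset.sum_smul, Matrix.trace,
        Matrix.diag_apply]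
    rw [ht, sub_add_eq_add_sub, ← sub_diag_eq_sum_lie]
  rw [h]
  have hP : ∀ j, Complex.I • Matrix.single j j (1 : ℂ) ∈ lieU N := fun j =>
    I_smul_mem_lieU (isHermitian_single_self j)
  exact L.add_mem (L.toSubmodule.sum_mem fun j _ => hdiag j)
    (L.smul_mem _ (L.toSubmodule.sum_mem fun j _ => hlie (hP j) ((lieU N).lie_mem (hP j) hM)))

/-- Traces on `𝔲(N)` are purely imaginary, so real multiples of one element of nonzero trace reach
every trace; the traceless part is already in `L`. -/
theorem lieU_le_of_trace_ne_zero {N : ℕ} [NeZero N]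
    {L : LieSubalgebra ℝ (Matrix (Fin N) (Fin N) ℂ)}
    (hL : lieU N ≤ adjoinCenter L) {M : Matrix (Fin N) (Fin N) ℂ} (hM : M ∈ lieU N) (hML : M ∈ L)
    (htr : M.trace ≠ 0) : lieU N ≤ L := by
  have him : ∀ A ∈ lieU N, A.trace = A.trace.im * Complex.I := by
    intro A hA
    have h1 : star A.trace = - A.trace := by
      rw [← Matrix.trace_conjTranspose, mem_lieU.1 hA, Matrix.trace_neg]
    apply Complex.ext
    · have := congrArg Complex.re h1
      simp at this ⊢
      linarith
    · simp
  have h0 : M.trace • Matrix.single (0 : Fin N) (0 : Fin N) (1 : ℂ) ∈ L := by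
    have := L.sub_mem hML (sub_trace_smul_single_mem hL 0 hM)
    rwa [sub_sub_cancel] at this
  have him0 : M.trace.im ≠ 0 := fun h => htr (by rw [him M hM, h]; simp)
  intro A hA
  have h1 := L.smul_mem (A.trace.im / M.trace.im) h0
  have h2 : (A.trace.im / M.trace.im) • M.trace • Matrix.single (0 : Fin N) (0 : Fin N) (1 : ℂ) =
      A.trace • Matrix.single 0 0 1 := by
    rw [← algebraMap_smul ℂ, smul_smul, Complex.coe_algebraMap]
    congr 1
    rw [him A hA, him M hM]
    have : (M.trace.im : ℂ) ≠ 0 := by exact_mod_cast him0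
    simp
    field_simp
  rw [h2] at h1
  have := L.add_mem (sub_trace_smul_single_mem hL 0 hA) h1
  rwa [sub_add_cancel] at this

/-! ### Commutants. -/

/-- Only the multiples of the identity commute with `𝔲(N)`. -/
theorem exists_eq_smul_one_of_commute {N : ℕ} {S : Matrix (Fin N) (Fin N) ℂ}
    (hS : ∀ M ∈ lieU N, Commute M S) : ∃ c : ℂ, S = c • 1 := by
  have h : S ∈ Set.range (Matrix.scalar (Fin N)) := by
    refine Matrix.mem_range_scalar_of_commute_single fun i j _ => ?_
    have h1 := hS _ (single_sub_single_mem_lieU i j)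
    have h2 := (hS _ (I_smul_mem_lieU (isHermitian_single_add_single i j))).smul_left (-Complex.I)
    rw [smul_smul, neg_mul, Complex.I_mul_I, neg_neg, one_smul] at h2
    have h3 := (h1.add_left h2).smul_left (1 / 2 : ℂ)
    have h4 : Matrix.single i j (1 : ℂ) = (1 / 2 : ℂ) • (Matrix.single i j 1 - Matrix.single j i 1
        + (Matrix.single i j 1 + Matrix.single j i 1)) := by module
    rwa [← h4] at h3
  obtain ⟨c, hc⟩ := h
  exact ⟨c, by rw [← hc, Matrix.scalar_apply, Matrix.smul_one_eq_diagonal]⟩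

/-- A matrix that commutes with two generators commutes with the Lie algebra they generate. -/
theorem commute_of_mem_dynamicalLieAlgebra {N : ℕ} {Hs Hc : Matrix (Config N) (Config N) ℂ}
    {S : Matrix (Fin N) (Fin N) ℂ} (hs : Commute (restrictOne Hs) S)
    (hc : Commute (restrictOne Hc) S) {M : Matrix (Fin N) (Fin N) ℂ}
    (hM : M ∈ dynamicalLieAlgebra Hs Hc) : Commute M S := by
  let C : LieSubalgebra ℝ (Matrix (Fin N) (Fin N) ℂ) :=
    { carrier := {M | Commute M S}
      zero_mem' := Commute.zero_left S
      add_mem' := fun ha hb => Commute.add_left ha hb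
      smul_mem' := fun c _ ha => Commute.smul_left ha c
      lie_mem' := fun {a b} (ha : Commute a S) (hb : Commute b S) => by
        change Commute ⁅a, b⁆ S
        rw [Ring.lie_def]
        exact (ha.mul_left hb).sub_left (hb.mul_left ha) }
  have h : dynamicalLieAlgebra Hs Hc ≤ C := by
    refine LieSubalgebra.lieSpan_le.2 ?_
    rintro _ (rfl | rfl)
    · exact hs.smul_left _
    · exact hc.smul_left _
  exact h hM

/-! ### The two equivalences. -/

theorem restrictOne_siteZ_isHermitian {N : ℕ} (k : Fin N) :
    (restrictOne (site pauliZ k)).IsHermitian := by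
  rw [restrictOne_siteZ]
  simp [Matrix.IsHermitian]

theorem trace_restrictOne_siteZ {N : ℕ} (k : Fin N) :
    (restrictOne (site pauliZ k)).trace = N - 2 := by
  simp [restrictOne_siteZ, Matrix.trace_sub]

theorem trace_restrictOne_heisenbergChain_two (g : ℝ) :
    (restrictOne (heisenbergChain 2 g)).trace = -g := by
  simp [Matrix.trace, restrictOne_heisenbergChain_apply, chainShift, chainCoupling,
    Fin.sum_univ_two]

theorem dynamicalLieAlgebra_eq_lieU {N : ℕ} {k : Fin N} {g : ℝ} (hg : g ≠ 0)
    (hc : Nat.Coprime N (2 * k + 1)) :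
    dynamicalLieAlgebra (heisenbergChain N g) (site pauliZ k) = lieU N := by
  have : NeZero N := ⟨k.pos.ne'⟩
  have hA := I_smul_mem_lieU (restrictOne_heisenbergChain_isHermitian N g)
  have hB := I_smul_mem_lieU (restrictOne_siteZ_isHermitian k)
  have hAL : Complex.I • restrictOne (heisenbergChain N g) ∈
      dynamicalLieAlgebra (heisenbergChain N g) (site pauliZ k) :=
    LieSubalgebra.subset_lieSpan (Or.inl rfl)
  have hBL : Complex.I • restrictOne (site pauliZ k) ∈
      dynamicalLieAlgebra (heisenbergChain N g) (site pauliZ k) :=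
    LieSubalgebra.subset_lieSpan (Or.inr rfl)
  refine le_antisymm (LieSubalgebra.lieSpan_le.2 ?_) ?_
  · rintro _ (rfl | rfl)
    exacts [hA, hB]
  have hL : lieU N ≤ adjoinCenter (dynamicalLieAlgebra (heisenbergChain N g) (site pauliZ k)) := by
    refine lieU_le_of_cyclic (restrictOne_heisenbergChain_isHermitian N g)
      (restrictOne_heisenbergChain_transpose N g)
      (fun v lam hv hk => eq_zero_of_mulVec_eq_smul hg hc hv hk) _ (le_adjoinCenter _ hAL) ?_
    -- From `Z_k = 1 - 2 E_kk`: `iE_kk - (i/2)·1 = -(1/2) iZ_k`.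
    refine mem_adjoinCenter.2 ⟨-1 / 2, ?_⟩
    convert LieSubalgebra.smul_mem _ (-1 / 2 : ℝ) hBL using 1
    rw [restrictOne_siteZ, ← algebraMap_smul ℂ (-1 / 2 : ℝ), Complex.coe_algebraMap]
    push_cast
    module
  -- `Z_k` has trace `N - 2`, so for `N = 2` the chain Hamiltonian, of trace `-g`, takes its place.
  rcases eq_or_ne N 2 with rfl | hN
  · refine lieU_le_of_trace_ne_zero hL hA hAL ?_
    rw [Matrix.trace_smul, trace_restrictOne_heisenbergChain_two]
    simpa using hg
  · refine lieU_le_of_trace_ne_zero hL hB hBL ?_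
    rw [Matrix.trace_smul, trace_restrictOne_siteZ]
    refine smul_ne_zero Complex.I_ne_zero (sub_ne_zero.2 ?_)
    exact_mod_cast hN

/-- If the position of `k` is not coprime to the length, the projection onto an eigenvector
vanishing at `k` commutes with both Hamiltonians. -/
theorem exists_symmetry {N : ℕ} (k : Fin N) (g : ℝ) (hc : ¬ Nat.Coprime N (2 * k + 1)) :
    ∃ S : Matrix (Fin N) (Fin N) ℂ, S.IsHermitian ∧
      Commute (restrictOne (heisenbergChain N g)) S ∧ Commute (restrictOne (site pauliZ k)) S ∧
      (∀ i, S i k = 0) ∧ ∃ i, S i i ≠ 0 := by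
  obtain ⟨v, lam, hv, hk, hreal, hne⟩ := exists_mulVec_eq_smul k g hc
  obtain ⟨i, hi⟩ := Function.ne_iff.1 hne
  refine ⟨Matrix.vecMulVec v v, ?_, ?_, ?_, fun i => by simp [Matrix.vecMulVec_apply, hk],
    i, by simpa [Matrix.vecMulVec_apply] using hi⟩
  · rw [Matrix.IsHermitian, Matrix.conjTranspose_vecMulVec, hreal]
  · rw [Commute, SemiconjBy, Matrix.mul_vecMulVec, Matrix.vecMulVec_mul, hv,
      ← Matrix.mulVec_transpose, restrictOne_heisenbergChain_transpose, hv]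
    ext a b
    simp [Matrix.vecMulVec_apply]
    ring
  · rw [restrictOne_siteZ]
    refine (Commute.one_left _).sub_left (Commute.smul_left ?_ _)
    ext a b
    simp [Matrix.mul_apply, Matrix.vecMulVec_apply, Matrix.single_apply, ite_and, hk]

theorem isControllableOne_iff {N : ℕ} (k : Fin N) {g : ℝ} (hg : g ≠ 0) :
    IsControllableOne (heisenbergChain N g) (site pauliZ k) ↔ Nat.Coprime N (2 * k + 1) := by
  refine ⟨fun h => ?_, fun h => Or.inl (dynamicalLieAlgebra_eq_lieU hg h)⟩
  by_contra hc
  obtain ⟨S, -, hs, hz, hk, i, hi⟩ := exists_symmetry k g hc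
  have hik : i ≠ k := by
    rintro rfl
    exact hi (hk i)
  -- This matrix is traceless, so it lies in both candidate algebras; the `(i, k)` entry of its
  -- commutation with `S` reads `S k k = S i i`, that is `0 = S i i`.
  have hmem : Matrix.single i k (1 : ℂ) - Matrix.single k i 1 ∈
      dynamicalLieAlgebra (heisenbergChain N g) (site pauliZ k) := by
    rcases h with h | h
    · rw [h]
      exact single_sub_single_mem_lieU i k
    · rw [h]
      exact mem_lieSU.2 ⟨single_sub_single_mem_lieU i k, by simp [hik, hik.symm]⟩
  have hcomm := commute_of_mem_dynamicalLieAlgebra hs hz hmem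
  have := congrFun (congrFun hcomm.eq i) k
  simp [sub_mul, mul_sub, hik, hik.symm, hk] at this
  exact hi this.symm

theorem not_hasSymmetryOne_iff {N : ℕ} (k : Fin N) {g : ℝ} (hg : g ≠ 0) :
    ¬ HasSymmetryOne (heisenbergChain N g) (site pauliZ k) ↔ Nat.Coprime N (2 * k + 1) := by
  refine ⟨fun h => ?_, ?_⟩
  · by_contra hc
    obtain ⟨S, hS, hs, hz, hk, i, hi⟩ := exists_symmetry k g hc
    refine h ⟨S, hS, ?_, hs, hz⟩
    rintro c rfl
    have hc0 : c = 0 := by simpa using hk k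
    simp [hc0] at hi
  · rintro h ⟨S, -, hne, hs, hz⟩
    obtain ⟨c, hc⟩ := exists_eq_smul_one_of_commute (S := S) fun M hM =>
      commute_of_mem_dynamicalLieAlgebra hs hz (by rwa [dynamicalLieAlgebra_eq_lieU hg h])
    exact hne c hc

end

end SpinChain

/-- Spins are numbered `0, …, N - 1` here, so `k.val + 1` is the position of the controlled spin
`k` in the numbering `1, …, N`. -/
theorem theorem10 (N : ℕ) (k : Fin N) (g : ℝ) (hg : g ≠ 0) :
    (SpinChain.IsControllableOne (SpinChain.heisenbergChain N g)
        (SpinChain.site SpinChain.pauliZ k) ↔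
      Nat.gcd N (2 * (k.val + 1) - 1) = 1) ∧
    (¬ SpinChain.HasSymmetryOne (SpinChain.heisenbergChain N g)
        (SpinChain.site SpinChain.pauliZ k) ↔
      Nat.gcd N (2 * (k.val + 1) - 1) = 1) := by
  rw [show 2 * (k.val + 1) - 1 = 2 * k.val + 1 by omega]
  exact ⟨SpinChain.isControllableOne_iff k hg, SpinChain.not_hasSymmetryOne_iff k hg⟩
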